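/- Let $n\ge 1$, let $T_n$ be a polynomial of degree $n$ with complex coefficients, put $T_n^{-1}([-1,1]):=\{z\in\mathbb{C}: T_n(z)\in[-1,1]\}$, and let $k\in\{1,2,\ldots,n\}$. Then $T_n^{-1}([-1,1])$ consists of exactly $k$ connected components, that is, there are $k$ connected components $B_1,\ldots,B_k$ of $T_n^{-1}([-1,1])$ with $B_1\cup\cdots\cup B_k=T_n^{-1}([-1,1])$ and $B_i\cap B_j=\emptyset$ for $i\neq j$, if and only if exactly $n-k$ zeros of the derivative $T_n'$, counted with multiplicity, lie in $T_n^{-1}([-1,1])$. -/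

import Mathlib

/-- The inverse image `T⁻¹([-1,1]) = {z ∈ ℂ : T(z) ∈ [-1,1]}` of the real interval `[-1,1]`
under a complex polynomial `T`. -/
def inverseImage (T : Polynomial ℂ) : Set ℂ :=
  {z : ℂ | ∃ x : ℝ, x ∈ Set.Icc (-1 : ℝ) 1 ∧ T.eval z = (x : ℂ)}

/-- `B` is one of the connected components of the set `S ⊆ ℂ` (with the subspace topology). -/
def IsConnectedComponentOf (S B : Set ℂ) : Prop :=
  ∃ z ∈ S, B = connectedComponentIn S z

open Classical in
/-- The number of zeros of `P` that lie in the set `S`, counted with multiplicity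
(for a nonzero polynomial `P`). -/
noncomputable def numZerosIn (P : Polynomial ℂ) (S : Set ℂ) : ℕ :=
  (P.roots.filter (fun z => z ∈ S)).card

open Polynomial Topology Filter Set

/-! Components are counted by linear algebra. For a connected set `S` containing `w₀`, a locally
constant function on `T⁻¹(S)` is determined by its values on the finite fibre `R` over `w₀`, because
`T` is open and proper and so maps each nonempty clopen piece onto `S`. Thus `extendable R` models
these functions inside `R → ℝ`, and for compact `S` its dimension is the number of components
(`ncard_components_eq_finrank`).

Now let `S` grow through the sublevel sets of a convex function. Components can merge only at zeros
of `T'`: near a zero of multiplicity `m` at most `m + 1` sectors meet, which costs at most `m`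
linear conditions. Hence the dimension drops by at most the number of zeros of `T'` over the added
region (`finrank_extendable_le`).

With `d` the dimension for `[-1,1]` and `m` the number of zeros of `T'` over it, two applications
suffice. Growing from `{-1}` to `[-1,1]` gives `n ≤ d + m`. Growing from `[-1,1]` to a large
rectangle, where only constants survive, gives `d ≤ 1 + (n - 1 - m)`. So `d + m = n`. -/

/-- `F` is locally constant on `X`, for the subspace topology of `X ⊆ ℂ`. -/
def LocConstOn {α : Type*} (X : Set ℂ) (F : ℂ → α) : Prop :=
  ∀ z ∈ X, ∀ᶠ ζ in 𝓝[X] z, F ζ = F z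

/-! ### Locally constant functions on subsets of the plane. -/

namespace LocConstOn

variable {α β : Type*} {X Y : Set ℂ} {F : ℂ → α}

theorem mono (hF : LocConstOn X F) (h : Y ⊆ X) : LocConstOn Y F := fun z hz =>
  (hF z (h hz)).filter_mono (nhdsWithin_mono z h)

theorem comp (hF : LocConstOn X F) (φ : α → β) : LocConstOn X (fun z => φ (F z)) := fun z hz =>
  (hF z hz).mono fun _ h => congrArg φ h

theorem prodMk {G : ℂ → β} (hF : LocConstOn X F) (hG : LocConstOn X G) :
    LocConstOn X (fun z => (F z, G z)) := fun z hz =>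
  ((hF z hz).and (hG z hz)).mono fun _ h => Prod.ext h.1 h.2

theorem pi {ι : Type*} [Finite ι] {G : ι → ℂ → α} (hG : ∀ i, LocConstOn X (G i)) :
    LocConstOn X (fun z i => G i z) := fun z hz =>
  (eventually_all.2 fun i => hG i z hz).mono fun _ h => funext h

theorem isLocallyConstant_domRestrict (hF : LocConstOn X F) : IsLocallyConstant (X.domRestrict F) := by
  rw [IsLocallyConstant.iff_eventually_eq]
  rintro ⟨z, hz⟩
  rw [nhds_subtype_eq_comap_nhdsWithin]
  exact (hF z hz).comap _

theorem eq_of_isPreconnected (hF : LocConstOn X F) (hX : IsPreconnected X) {x y : ℂ}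
    (hx : x ∈ X) (hy : y ∈ X) : F x = F y := by
  have := isPreconnected_iff_preconnectedSpace.1 hX
  exact hF.isLocallyConstant_domRestrict.apply_eq_of_preconnectedSpace ⟨x, hx⟩ ⟨y, hy⟩

/-- A function that is locally constant on a compact set extends to a locally constant function
on an open neighbourhood. -/
theorem exists_extension (hF : LocConstOn X F) (hX : IsCompact X) :
    ∃ O, IsOpen O ∧ X ⊆ O ∧ ∃ G : ℂ → α, LocConstOn O G ∧ ∀ z ∈ X, G z = F z := by
  have h1 : ∀ z : X, ∃ δ > 0, ∀ ζ ∈ X, ζ ∈ Metric.ball (z : ℂ) δ → F ζ = F z := by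
    rintro ⟨z, hz⟩
    obtain ⟨δ, hδ, h⟩ := Metric.mem_nhdsWithin_iff.1 (hF z hz)
    exact ⟨δ, hδ, fun ζ hζ hb => h ⟨hb, hζ⟩⟩
  choose d hd hdF using h1
  -- A Lebesgue number makes the radius uniform: points of `X` closer than `δ` share a value.
  obtain ⟨δ, hδ, hL⟩ := lebesgue_number_lemma_of_metric (c := fun z : X => Metric.ball (z : ℂ) (d z))
    hX (fun _ => Metric.isOpen_ball)
    (fun z hz => mem_iUnion.2 ⟨⟨z, hz⟩, Metric.mem_ball_self (hd _)⟩)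
  have hU : ∀ x ∈ X, ∀ y ∈ X, dist x y < δ → F x = F y := by
    intro x hx y hy hxy
    obtain ⟨i, hi⟩ := hL x hx
    rw [hdF i x hx (hi (Metric.mem_ball_self hδ)),
      hdF i y hy (hi (by rwa [Metric.mem_ball, dist_comm]))]
  have hO : ∀ ζ, ∃ x, ζ ∈ Metric.thickening (δ / 3) X → x ∈ X ∧ dist ζ x < δ / 3 := by
    intro ζ
    by_cases h : ζ ∈ Metric.thickening (δ / 3) X
    · obtain ⟨x, hx, h'⟩ := Metric.mem_thickening_iff.1 h
      exact ⟨x, fun _ => ⟨hx, h'⟩⟩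
    · exact ⟨0, fun h' => absurd h' h⟩
  choose p hp using hO
  -- One third, since nearby `ζ` and `z` are compared along the chain `p ζ, ζ, z, p z`.
  have hXO := Metric.self_subset_thickening (show 0 < δ / 3 by positivity) X
  refine ⟨_, Metric.isOpen_thickening, hXO, fun ζ => F (p ζ), ?_, ?_⟩
  · intro z hz
    filter_upwards [self_mem_nhdsWithin,
      mem_nhdsWithin_of_mem_nhds (Metric.ball_mem_nhds z (show 0 < δ / 3 by positivity))]
      with ζ hζ hζz
    refine hU _ (hp ζ hζ).1 _ (hp z hz).1 ?_
    have h1 := (hp ζ hζ).2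
    have h2 := (hp z hz).2
    rw [Metric.mem_ball] at hζz
    have h3 := dist_triangle4 (p ζ) ζ z (p z)
    rw [dist_comm (p ζ) ζ] at h3
    linarith
  · intro z hz
    have h2 := hp z (hXO hz)
    refine hU _ h2.1 _ hz ?_
    rw [dist_comm]
    linarith [h2.2]

end LocConstOn

/-! ### Locally constant functions and fibres of a polynomial. -/

section Fibres

variable {T : ℂ[X]} {S : Set ℂ}

/-- A polynomial map is open and proper, so a locally constant function on the preimage of a
preconnected set takes each of its values on every fibre. -/
theorem LocConstOn.exists_eq_on_fibre {α : Type*} (hT : T.natDegree ≠ 0) (hS : IsPreconnected S)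
    {G : ℂ → α} (hG : LocConstOn (T.eval ⁻¹' S) G) {z : ℂ} (hz : T.eval z ∈ S) {w : ℂ}
    (hw : w ∈ S) : ∃ ζ, T.eval ζ = w ∧ G ζ = G z := by
  have := isPreconnected_iff_preconnectedSpace.1 hS
  have hdeg : 0 < T.degree := natDegree_pos_iff_degree_pos.1 (Nat.pos_of_ne_zero hT)
  have hopen := (T.isOpenQuotientMap_eval hT).isOpenMap.restrictPreimage S
  have hclosed := (T.isProperMap_eval hdeg).isClosedMap.restrictPreimage S
  have hA : IsClopen {ζ : T.eval ⁻¹' S | G ζ = G z} :=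
    hG.isLocallyConstant_domRestrict.isClopen_fiber (G z)
  have hA' : IsClopen (S.restrictPreimage T.eval '' {ζ : T.eval ⁻¹' S | G ζ = G z}) :=
    ⟨hclosed _ hA.1, hopen _ hA.2⟩
  have huniv := hA'.eq_univ ⟨_, ⟨z, hz⟩, rfl, rfl⟩
  obtain ⟨ζ, hζ, hζw⟩ := huniv.ge (mem_univ (⟨w, hw⟩ : S))
  exact ⟨ζ, congrArg Subtype.val hζw, hζ⟩

/-- Two locally constant functions on the preimage of a preconnected set agree if they agree on one
fibre. -/
theorem LocConstOn.eqOn_of_eq_on_fibre {α : Type*} (hT : T.natDegree ≠ 0) (hS : IsPreconnected S)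
    {F G : ℂ → α} (hF : LocConstOn (T.eval ⁻¹' S) F) (hG : LocConstOn (T.eval ⁻¹' S) G)
    {w : ℂ} (hw : w ∈ S) (h : ∀ x, T.eval x = w → F x = G x) : EqOn F G (T.eval ⁻¹' S) := by
  intro z hz
  -- Using the pair yields one fibre point that carries both values at once.
  obtain ⟨ζ, hζ, hFG⟩ := (hF.prodMk hG).exists_eq_on_fibre hT hS hz hw
  have h1 := h ζ hζ
  simp only [Prod.mk.injEq] at hFG
  rw [← hFG.1, h1, hFG.2]

/-- A point of the preimage of a preconnected set cannot be separated from all the points of a given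
fibre by locally constant functions. -/
theorem exists_fibre_point_not_separated (hT : T.natDegree ≠ 0) (hS : IsPreconnected S) {w : ℂ}
    (hw : w ∈ S) {y : ℂ} (hy : T.eval y ∈ S) :
    ∃ x, T.eval x = w ∧ ∀ F : ℂ → ℝ, LocConstOn (T.eval ⁻¹' S) F → F y = F x := by
  by_contra! hcon
  have hT0 : T - C w ≠ 0 := fun h => hT (by rw [sub_eq_zero.1 h, natDegree_C])
  have hfin : Finite {x : ℂ // T.eval x = w} := by
    refine ((T - C w).roots.toFinset.finite_toSet.subset ?_).to_subtype
    intro x hx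
    replace hx : T.eval x = w := hx
    simpa [hT0, sub_eq_zero] using hx
  choose! F hF hne using hcon
  -- The separating functions, one per fibre point, are bundled into one; finiteness of the fibre
  -- keeps it locally constant.
  obtain ⟨ζ, hζ, h⟩ := (LocConstOn.pi (G := fun x : {x : ℂ // T.eval x = w} => F x)
    (fun x => hF x x.2)).exists_eq_on_fibre hT hS hy hw
  exact hne ζ hζ (congrFun h ⟨ζ, hζ⟩).symm

end Fibres

/-! ### Local degree at a critical point. -/

section LocalDegree

variable {T : ℂ[X]}

/-- In characteristic zero, differentiation lowers the order of a root by exactly one. -/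
theorem rootMultiplicity_sub_C_eval (hT : T.natDegree ≠ 0) (z : ℂ) :
    (T - C (T.eval z)).rootMultiplicity z = (derivative T).rootMultiplicity z + 1 := by
  have hT0 : T - C (T.eval z) ≠ 0 := fun h => hT (by rw [sub_eq_zero.1 h, natDegree_C])
  have hroot : (T - C (T.eval z)).IsRoot z := by simp
  have h := derivative_rootMultiplicity_of_root hroot
  have hpos := (rootMultiplicity_pos hT0).2 hroot
  simp only [derivative_sub, derivative_C, sub_zero] at h
  omega

/-- Near `z`, a polynomial `T` takes each value at most `m + 1` times, where `m` is the multiplicity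
of `z` as a zero of `T'`. -/
theorem exists_nhds_card_fibre_le (hT : T.natDegree ≠ 0) (z : ℂ) :
    ∃ U ∈ 𝓝 z, ∀ w, ∀ s : Finset ℂ, (∀ ζ ∈ s, ζ ∈ U ∧ T.eval ζ = w) →
      s.card ≤ (derivative T).rootMultiplicity z + 1 := by
  have hT0 : T - C (T.eval z) ≠ 0 := fun h => hT (by rw [sub_eq_zero.1 h, natDegree_C])
  obtain ⟨q, hq, hdvd⟩ := (T - C (T.eval z)).exists_eq_pow_rootMultiplicity_mul_and_not_dvd hT0 z
  rw [rootMultiplicity_sub_C_eval hT] at hq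
  set e := (derivative T).rootMultiplicity z + 1 with he
  have hqz : q.eval z ≠ 0 := fun h => hdvd (dvd_iff_isRoot.2 h)
  -- A local coordinate with `T - T z = q(z) ψ ^ e`. The base of the power is `1` at `z`, so the
  -- principal branch is differentiable there and `ψ' z = 1`.
  set ψ : ℂ → ℂ := fun ζ => (ζ - z) * (q.eval ζ / q.eval z) ^ (1 / (e : ℂ)) with hψ
  have hψe : ∀ ζ, ψ ζ ^ e = (T.eval ζ - T.eval z) / q.eval z := by
    intro ζ
    have h1 := congrArg (eval ζ) hq
    simp only [eval_sub, eval_C, eval_mul, eval_pow, eval_X] at h1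
    rw [h1, hψ]
    simp only [mul_pow, one_div]
    rw [Complex.cpow_nat_inv_pow _ (by omega)]
    ring
  have h1 : HasStrictDerivAt ψ 1 z := by
    have ha : HasStrictDerivAt (fun ζ => ζ - z) 1 z := (hasStrictDerivAt_id z).sub_const z
    have hb : HasStrictDerivAt (fun ζ => q.eval ζ / q.eval z)
        ((derivative q).eval z / q.eval z) z := (q.hasStrictDerivAt z).div_const _
    have hc := hb.cpow (hasStrictDerivAt_const z (1 / (e : ℂ))) (by simp [hqz])
    exact (ha.mul hc).congr_deriv (by simp [hqz])
  refine ⟨(h1.hasStrictFDerivAt_equiv one_ne_zero).toOpenPartialHomeomorph ψ |>.source,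
    (h1.hasStrictFDerivAt_equiv one_ne_zero).toOpenPartialHomeomorph ψ |>.open_source.mem_nhds
      (HasStrictFDerivAt.mem_toOpenPartialHomeomorph_source _), ?_⟩
  intro w s hs
  classical
  have hinj : InjOn ψ s := ((h1.hasStrictFDerivAt_equiv one_ne_zero).toOpenPartialHomeomorph
    ψ).injOn.mono fun ζ hζ => (hs ζ hζ).1
  rw [← Finset.card_image_of_injOn hinj]
  have hsub : s.image ψ ⊆ (nthRoots e ((w - T.eval z) / q.eval z)).toFinset := by
    intro x hx
    obtain ⟨ζ, hζ, rfl⟩ := Finset.mem_image.1 hx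
    rw [Multiset.mem_toFinset, mem_nthRoots (by omega), hψe, (hs ζ hζ).2]
  exact (Finset.card_le_card hsub).trans ((Multiset.toFinset_card_le _).trans (card_nthRoots _ _))

end LocalDegree

/-! ### Sectors over a convex set at a boundary point. -/

section Sectors

variable {T : ℂ[X]} {V : Set ℂ}

/-- Let `V` be convex, `T z ∈ closure V`, and let `m` be the multiplicity of `z` as a zero of `T'`.
Near `z` the set `T⁻¹(V)` consists of at most `m + 1` sectors; so `m` equations between values on a
fixed fibre force a locally constant function on `T⁻¹(V)` to be constant near `z`. -/
theorem exists_finset_forall_eventually_const (hT : T.natDegree ≠ 0) (hV : Convex ℝ V) {w₀ : ℂ}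
    (hw₀ : w₀ ∈ V) {z : ℂ} (hz : T.eval z ∈ closure V) :
    ∃ (x₀ : ℂ) (A : Finset ℂ), T.eval x₀ = w₀ ∧ (∀ x ∈ A, T.eval x = w₀) ∧
      A.card ≤ (derivative T).rootMultiplicity z ∧
      ∀ F : ℂ → ℝ, LocConstOn (T.eval ⁻¹' V) F → (∀ x ∈ A, F x = F x₀) →
        ∃ v, ∀ᶠ ζ in 𝓝 z, ζ ∈ T.eval ⁻¹' V → F ζ = v := by
  classical
  have hT0 : ∀ w, T - C w ≠ 0 := fun w h => hT (by rw [sub_eq_zero.1 h, natDegree_C])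
  obtain ⟨U, hU, hcard⟩ := exists_nhds_card_fibre_le hT z
  obtain ⟨δ₁, hδ₁, hballU⟩ := Metric.mem_nhds_iff.1 hU
  have hiso : ∀ᶠ ζ in 𝓝[≠] z, T.eval ζ ≠ T.eval z := by
    have hf : {ζ | T.eval ζ = T.eval z}.Finite := by
      refine (T - C (T.eval z)).roots.toFinset.finite_toSet.subset fun x hx => ?_
      replace hx : T.eval x = T.eval z := hx
      simpa [hT0, sub_eq_zero] using hx
    have h1 := (hf.subset (sdiff_subset (t := {z}))).isClosed.isOpen_compl.mem_nhds
      (show z ∈ ({ζ | T.eval ζ = T.eval z} \ {z})ᶜ by simp)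
    filter_upwards [mem_nhdsWithin_of_mem_nhds h1, self_mem_nhdsWithin] with ζ h2 h3 h4
    exact h2 ⟨h4, h3⟩
  obtain ⟨δ₂, hδ₂, hpunct⟩ := Metric.mem_nhdsWithin_iff.1 hiso
  -- Halving `δ₂` puts the whole sphere, not just the open ball, where `T` avoids the value `T z`.
  set δ := min δ₁ (δ₂ / 2) with hδdef
  have hδ : 0 < δ := by positivity
  have hsphere : T.eval z ∉ T.eval '' Metric.sphere z δ := by
    rintro ⟨ζ, hζ, h⟩
    rw [mem_sphere_iff_norm, ← dist_eq_norm] at hζ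
    refine hpunct ⟨?_, ?_⟩ h
    · rw [Metric.mem_ball, hζ]
      linarith [min_le_right δ₁ (δ₂ / 2)]
    · rintro rfl
      simp at hζ
      linarith
  obtain ⟨ε, hε, hεs⟩ := Metric.isOpen_iff.1
    ((isCompact_sphere z δ).image T.continuous).isClosed.isOpen_compl _ hsphere
  have hopen : T.eval '' Metric.ball z δ ∩ Metric.ball (T.eval z) ε ∈ 𝓝 (T.eval z) :=
    inter_mem ((T.isOpenQuotientMap_eval hT).isOpenMap.image_mem_nhds (Metric.ball_mem_nhds z hδ))
      (Metric.ball_mem_nhds _ hε)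
  obtain ⟨w₁, ⟨⟨y₀, hy₀, hy₀w⟩, hw₁ε⟩, hw₁V⟩ := mem_closure_iff_nhds.1 hz _ hopen
  set Y := V ∩ Metric.ball (T.eval z) ε with hY
  have hYc : IsPreconnected Y := (hV.inter (convex_ball _ _)).isPreconnected
  set s := (T - C w₁).roots.toFinset.filter (· ∈ Metric.ball z δ) with hs
  have hmems : ∀ ζ, ζ ∈ s ↔ T.eval ζ = w₁ ∧ ζ ∈ Metric.ball z δ := by
    intro ζ
    simp [hs, hT0, sub_eq_zero]
  have hscard : s.card ≤ (derivative T).rootMultiplicity z + 1 := by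
    refine hcard w₁ s fun ζ hζ => ?_
    have h := (hmems ζ).1 hζ
    exact ⟨hballU (Metric.ball_subset_ball (min_le_left _ _) h.2), h.1⟩
  have hy₀s : y₀ ∈ s := (hmems _).2 ⟨hy₀w, hy₀⟩
  -- Conditions at the points over the auxiliary value `w₁` are transported to the fixed fibre over
  -- `w₀`.
  have hpt : ∀ y, ∃ x, T.eval y = w₁ → T.eval x = w₀ ∧
      ∀ F : ℂ → ℝ, LocConstOn (T.eval ⁻¹' V) F → F y = F x := by
    intro y
    by_cases h : T.eval y = w₁
    · obtain ⟨x, hx⟩ := exists_fibre_point_not_separated hT hV.isPreconnected hw₀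
        (show T.eval y ∈ V by rwa [h])
      exact ⟨x, fun _ => hx⟩
    · exact ⟨0, fun h' => absurd h' h⟩
  choose x hx using hpt
  -- Equating `m + 1` values takes only `m` equations, hence the erased point.
  refine ⟨x y₀, (s.erase y₀).image x, (hx y₀ hy₀w).1, ?_, ?_, ?_⟩
  · intro a ha
    obtain ⟨y, hy, rfl⟩ := Finset.mem_image.1 ha
    exact (hx y ((hmems y).1 (Finset.mem_of_mem_erase hy)).1).1
  · refine Finset.card_image_le.trans ?_
    rw [Finset.card_erase_of_mem hy₀s]
    omega
  · intro F hF hFA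
    have hFs : ∀ y ∈ s, F y = F y₀ := by
      intro y hy
      rcases eq_or_ne y y₀ with rfl | hne
      · rfl
      · rw [(hx y ((hmems y).1 hy).1).2 F hF, (hx y₀ hy₀w).2 F hF]
        exact hFA _ (Finset.mem_image_of_mem _ (Finset.mem_erase.2 ⟨hne, hy⟩))
    -- Over `Y` no preimage lies on the sphere, so lying in the disc is a locally constant property.
    have hball : LocConstOn (T.eval ⁻¹' Y) (fun η => η ∈ Metric.ball z δ) := by
      intro η hη
      refine Filter.Eventually.filter_mono nhdsWithin_le_nhds ?_
      by_cases h : η ∈ Metric.ball z δ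
      · filter_upwards [Metric.isOpen_ball.mem_nhds h] with ζ hζ
        simp only [hζ, h]
      · have h' : η ∈ (Metric.closedBall z δ)ᶜ := by
          intro hc
          rcases (Metric.mem_closedBall.1 hc).lt_or_eq with h1 | h1
          · exact h h1
          · exact hεs hη.2 ⟨η, h1, rfl⟩
        filter_upwards [Metric.isClosed_closedBall.isOpen_compl.mem_nhds h'] with ζ hζ
        have hζ' : ζ ∉ Metric.ball z δ := fun hb => hζ (Metric.ball_subset_closedBall hb)
        simp only [hζ', h]
    refine ⟨F y₀, ?_⟩
    filter_upwards [Metric.ball_mem_nhds z hδ,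
      T.continuous.continuousAt.preimage_mem_nhds (Metric.ball_mem_nhds (T.eval z) hε)]
      with ζ hζ hζε hζV
    obtain ⟨η, hηw, hη⟩ := (hball.prodMk (hF.mono (preimage_mono inter_subset_left))).exists_eq_on_fibre
      hT hYc (z := ζ) ⟨hζV, hζε⟩ (w := w₁) ⟨hw₁V, hw₁ε⟩
    simp only [Prod.mk.injEq, eq_iff_iff] at hη
    rw [← hη.2, hFs η ((hmems η).2 ⟨hηw, hη.1.2 hζ⟩)]

end Sectors

/-! ### Dimension loss along convex sublevel sets. -/

/-- The real functions on the finite set `R` that extend to a locally constant function on `X`. -/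
def extendable (R : Finset ℂ) (X : Set ℂ) : Submodule ℝ (R → ℝ) where
  carrier := {f | ∃ F : ℂ → ℝ, LocConstOn X F ∧ ∀ x : R, F x = f x}
  zero_mem' := ⟨fun _ => 0, fun _ _ => Eventually.of_forall fun _ => rfl, fun _ => rfl⟩
  add_mem' := by
    rintro f g ⟨F, hF, hFf⟩ ⟨G, hG, hGg⟩
    exact ⟨fun z => F z + G z, (hF.prodMk hG).comp fun p => p.1 + p.2,
      fun x => by simp [hFf, hGg]⟩
  smul_mem' := by
    rintro c f ⟨F, hF, hFf⟩
    exact ⟨fun z => c * F z, hF.comp fun a => c * a, fun x => by simp [hFf]⟩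

theorem extendable_anti {R : Finset ℂ} {X Y : Set ℂ} (h : Y ⊆ X) :
    extendable R X ≤ extendable R Y := fun _ ⟨F, hF, hf⟩ => ⟨F, hF.mono h, hf⟩

section Growth

variable {T : ℂ[X]} {D : Set ℂ} {h : ℂ → ℝ} {R : Finset ℂ} {w₀ : ℂ} {a : ℝ}

/-- Extendability passes from a compact sublevel set to slightly larger ones. -/
theorem exists_gt_mem_extendable (hT : T.natDegree ≠ 0) (hh : Continuous h)
    (hcomp : ∀ r, IsCompact {w ∈ D | h w ≤ r}) {r : ℝ}
    (hRr : ∀ x ∈ R, T.eval x ∈ {w ∈ D | h w ≤ r}) {f : R → ℝ}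
    (hf : f ∈ extendable R (T.eval ⁻¹' {w ∈ D | h w ≤ r})) :
    ∃ r' > r, f ∈ extendable R (T.eval ⁻¹' {w ∈ D | h w ≤ r'}) := by
  have hdeg : 0 < T.degree := natDegree_pos_iff_degree_pos.1 (Nat.pos_of_ne_zero hT)
  have hpc : ∀ r, IsCompact (T.eval ⁻¹' {w ∈ D | h w ≤ r}) := fun r =>
    (T.isProperMap_eval hdeg).isCompact_preimage (hcomp r)
  obtain ⟨F, hF, hFf⟩ := hf
  obtain ⟨O, hO, hXO, G, hG, hGF⟩ := hF.exists_extension (hpc r)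
  have hK : IsCompact (T.eval ⁻¹' {w ∈ D | h w ≤ r + 1} \ O) := (hpc _).diff hO
  have hc : ContinuousOn (fun z => h (T.eval z)) (T.eval ⁻¹' {w ∈ D | h w ≤ r + 1} \ O) :=
    (hh.comp T.continuous).continuousOn
  -- On the compact part outside `O`, `h ∘ T` has a minimum exceeding `r`; a level halfway to it
  -- stays inside `O`.
  have key : ∃ r' > r, T.eval ⁻¹' {w ∈ D | h w ≤ r'} ⊆ O := by
    rcases (T.eval ⁻¹' {w ∈ D | h w ≤ r + 1} \ O).eq_empty_or_nonempty with he | hne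
    · exact ⟨r + 1, by linarith, sdiff_eq_empty.1 he⟩
    · obtain ⟨z, hz, hmin⟩ := hK.exists_isMinOn hne hc
      have hrz : r < h (T.eval z) := by
        by_contra! hle
        exact hz.2 (hXO ⟨hz.1.1, hle⟩)
      refine ⟨(r + h (T.eval z)) / 2, by linarith, fun ζ hζ => ?_⟩
      by_contra hζO
      have h1 := hz.1.2
      have h2 : h (T.eval z) ≤ h (T.eval ζ) := hmin ⟨⟨hζ.1, by linarith [hζ.2]⟩, hζO⟩
      linarith [hζ.2]
  obtain ⟨r', hr', hsub⟩ := key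
  exact ⟨r', hr', G, hG.mono hsub, fun x => by rw [hGF _ (hRr x x.2), hFf]⟩

/-- Extensions to all smaller sublevel sets glue to an extension to the strict sublevel set. -/
theorem mem_extendable_of_forall_lt (hT : T.natDegree ≠ 0) (hh : ConvexOn ℝ D h)
    (hhc : Continuous h) (hR : ∀ x, x ∈ R ↔ T.eval x = w₀) (hw₀ : w₀ ∈ D) (hw₀a : h w₀ ≤ a)
    {r : ℝ} (hr : a < r) {f : R → ℝ}
    (hf : ∀ s, a ≤ s → s < r → f ∈ extendable R (T.eval ⁻¹' {w ∈ D | h w ≤ s})) :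
    f ∈ extendable R (T.eval ⁻¹' {w ∈ D | h w < r}) := by
  choose! F hF hFf using hf
  have hagree : ∀ s t, a ≤ s → s ≤ t → t < r →
      EqOn (F s) (F t) (T.eval ⁻¹' {w ∈ D | h w ≤ s}) := by
    intro s t has hst htr
    refine (hF s has (hst.trans_lt htr)).eqOn_of_eq_on_fibre hT (hh.convex_le s).isPreconnected
      ((hF t (has.trans hst) htr).mono fun z hz => ⟨hz.1, hz.2.trans hst⟩)
      (w := w₀) ⟨hw₀, hw₀a.trans has⟩ fun x hx => ?_
    rw [hFf s has (hst.trans_lt htr) ⟨x, (hR x).2 hx⟩,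
      hFf t (has.trans hst) htr ⟨x, (hR x).2 hx⟩]
  -- Each point uses the extension for its own level, raised to `a` because none is given below `a`.
  refine ⟨fun z => F (max a (h (T.eval z))) z, ?_, ?_⟩
  · have heq : ∀ s, a ≤ s → s < r → ∀ ζ, T.eval ζ ∈ D → h (T.eval ζ) ≤ s →
        F (max a (h (T.eval ζ))) ζ = F s ζ := fun s has hsr ζ hζD hζ =>
      hagree _ s (le_max_left _ _) (max_le has hζ) hsr ⟨hζD, le_max_right _ _⟩
    intro z hz
    obtain ⟨s, hs1, hs2⟩ := exists_between (max_lt hr hz.2)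
    have has : a ≤ s := (le_max_left _ _).trans hs1.le
    have hzs : h (T.eval z) < s := (le_max_right _ _).trans_lt hs1
    have hev : ∀ᶠ ζ in 𝓝 z, h (T.eval ζ) < s :=
      (hhc.comp T.continuous).continuousAt.eventually_lt_const hzs
    have hlc := hF s has hs2 z ⟨hz.1, hzs.le⟩
    rw [eventually_nhdsWithin_iff] at hlc ⊢
    filter_upwards [hev, hlc] with ζ h1 h2 h3
    rw [heq s has hs2 ζ h3.1 h1.le, heq s has hs2 z hz.1 hzs.le, h2 ⟨h3.1, h1.le⟩]
  · intro x
    have hx := (hR x).1 x.2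
    simp only [hx, max_eq_left hw₀a]
    exact hFf a le_rfl hr x

/-- Convexity keeps `h` below `h w` on the open segment from `w` to `w₀`, which accumulates at `w`.
-/
theorem mem_closure_sublevel_lt (hh : ConvexOn ℝ D h) (hw₀ : w₀ ∈ D) {w : ℂ} (hw : w ∈ D)
    (hlt : h w₀ < h w) : w ∈ closure {w' ∈ D | h w' < h w} := by
  have hsub : openSegment ℝ w w₀ ⊆ {w' ∈ D | h w' < h w} := by
    rintro _ ⟨s, t, hs, ht, hst, rfl⟩
    refine ⟨hh.1 hw hw₀ hs.le ht.le hst, (hh.2 hw hw₀ hs.le ht.le hst).trans_lt ?_⟩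
    simp only [smul_eq_mul]
    calc s * h w + t * h w₀ < s * h w + t * h w := by gcongr
      _ = h w := by rw [← add_mul, hst, one_mul]
  refine closure_mono hsub ?_
  rw [closure_openSegment]
  exact left_mem_segment ℝ w w₀

/-- A locally constant function on the preimage of a strict sublevel set extends to the closed
sublevel set if it is constant near each preimage of the level set. -/
theorem mem_extendable_of_eventually_const (hT : T.natDegree ≠ 0) (hh : ConvexOn ℝ D h)
    (hhc : Continuous h) (hw₀ : w₀ ∈ D) (hw₀a : h w₀ ≤ a) (hR : ∀ x, x ∈ R ↔ T.eval x = w₀)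
    {r : ℝ} (hr : a < r) {F : ℂ → ℝ} (hF : LocConstOn (T.eval ⁻¹' {w ∈ D | h w < r}) F)
    (hlev : ∀ z, T.eval z ∈ D → h (T.eval z) = r →
      ∃ v, ∀ᶠ ζ in 𝓝 z, ζ ∈ T.eval ⁻¹' {w ∈ D | h w < r} → F ζ = v) :
    (fun x : R => F x) ∈ extendable R (T.eval ⁻¹' {w ∈ D | h w ≤ r}) := by
  classical
  choose! v hv using hlev
  refine ⟨fun z => if h (T.eval z) < r then F z else v z, ?_, ?_⟩
  · intro z hz
    rw [eventually_nhdsWithin_iff]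
    rcases hz.2.lt_or_eq with hlt | heq
    · have hlc := hF z ⟨hz.1, hlt⟩
      rw [eventually_nhdsWithin_iff] at hlc
      have hev : ∀ᶠ ζ in 𝓝 z, h (T.eval ζ) < r :=
        (hhc.comp T.continuous).continuousAt.eventually_lt_const hlt
      filter_upwards [hev, hlc] with ζ h1 h2 h3
      simp only [h1, hlt, if_true]
      exact h2 ⟨h3.1, h1⟩
    -- A nearby level-set point `ζ` has its own constant `v ζ`; it equals `v z` because both are
    -- read off at a common point `η` of the strict sublevel preimage.
    · filter_upwards [eventually_eventually_nhds.2 (hv z hz.1 heq)] with ζ h2 h3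
      rw [if_neg heq.not_lt]
      rcases h3.2.lt_or_eq with hlt' | heq'
      · rw [if_pos hlt']
        exact h2.self_of_nhds ⟨h3.1, hlt'⟩
      · rw [if_neg heq'.not_lt]
        have hcl : ζ ∈ closure (T.eval ⁻¹' {w ∈ D | h w < r}) := by
          refine (T.isOpenQuotientMap_eval hT).isOpenMap.preimage_closure_subset_closure_preimage ?_
          have := mem_closure_sublevel_lt hh hw₀ h3.1 (heq'.symm ▸ hw₀a.trans_lt hr)
          rwa [heq'] at this
        obtain ⟨η, ⟨h5, h6⟩, h7⟩ := ((h2.and (hv ζ h3.1 heq')).and_frequently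
          (mem_closure_iff_frequently.1 hcl)).exists
        rw [← h5 h7, h6 h7]
  · intro x
    have hx := (hR x).1 x.2
    simp only [hx, hw₀a.trans_lt hr, if_true]

/-- Let `h` be convex with compact sublevel sets in `D`. When the sublevel `a` is raised to `b`, the
space of locally constant functions on the preimage under `T` loses at most as many dimensions as
there are zeros of `T'` over the added part of the sublevel set. -/
theorem finrank_extendable_le (hT : T.natDegree ≠ 0) (hh : ConvexOn ℝ D h) (hhc : Continuous h)
    (hcomp : ∀ r, IsCompact {w ∈ D | h w ≤ r}) (hw₀ : w₀ ∈ D) (hw₀a : h w₀ ≤ a)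
    (hR : ∀ x, x ∈ R ↔ T.eval x = w₀) {b : ℝ} (hab : a ≤ b) :
    Module.finrank ℝ (extendable R (T.eval ⁻¹' {w ∈ D | h w ≤ a})) ≤
      Module.finrank ℝ (extendable R (T.eval ⁻¹' {w ∈ D | h w ≤ b})) +
        numZerosIn (derivative T) {z | T.eval z ∈ D ∧ a < h (T.eval z)} := by
  classical
  have hsec : ∀ z, T.eval z ∈ D ∧ a < h (T.eval z) → ∃ (x₀ : ℂ) (A : Finset ℂ), T.eval x₀ = w₀ ∧
      (∀ x ∈ A, T.eval x = w₀) ∧ A.card ≤ (derivative T).rootMultiplicity z ∧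
      ∀ F : ℂ → ℝ, LocConstOn (T.eval ⁻¹' {w ∈ D | h w < h (T.eval z)}) F →
        (∀ x ∈ A, F x = F x₀) →
        ∃ v, ∀ᶠ ζ in 𝓝 z, ζ ∈ T.eval ⁻¹' {w ∈ D | h w < h (T.eval z)} → F ζ = v := by
    rintro z ⟨hzD, hz⟩
    exact exists_finset_forall_eventually_const hT (hh.convex_lt _) ⟨hw₀, hw₀a.trans_lt hz⟩
      (mem_closure_sublevel_lt hh hw₀ hzD (hw₀a.trans_lt hz))
  choose! x₀ A hx₀ hA hcard hconst using hsec
  set M := (derivative T).roots.filter (· ∈ {z | T.eval z ∈ D ∧ a < h (T.eval z)}) with hM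
  have hMP : ∀ z ∈ M.toFinset, T.eval z ∈ D ∧ a < h (T.eval z) := fun z hz =>
    (Multiset.mem_filter.1 (Multiset.mem_toFinset.1 hz)).2
  let Q := Σ z : M.toFinset, A z
  -- All gluing equations at all relevant critical points; their number is at most the number of
  -- zeros with multiplicity.
  let Φ : (R → ℝ) →ₗ[ℝ] (Q → ℝ) := LinearMap.pi fun q =>
    LinearMap.proj (R := ℝ) (φ := fun _ : R => ℝ) (⟨q.2, (hR _).2 (hA _ (hMP _ q.1.2) _ q.2.2)⟩ : R) -
      LinearMap.proj (R := ℝ) (φ := fun _ : R => ℝ) (⟨x₀ q.1, (hR _).2 (hx₀ _ (hMP _ q.1.2))⟩ : R)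
  have hQ : Fintype.card Q ≤ M.card := by
    simp only [Q, Fintype.card_sigma, Fintype.card_coe]
    rw [Finset.sum_coe_sort M.toFinset fun z => (A z).card, ← Multiset.toFinset_sum_count_eq M]
    refine Finset.sum_le_sum fun z hz => ?_
    have hcount : M.count z = (derivative T).roots.count z := by
      rw [hM]
      exact Multiset.count_filter_of_pos (hMP z hz)
    rw [hcount, count_roots]
    exact hcard z (hMP z hz)
  have key : extendable R (T.eval ⁻¹' {w ∈ D | h w ≤ a}) ⊓ LinearMap.ker Φ ≤
      extendable R (T.eval ⁻¹' {w ∈ D | h w ≤ b}) := by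
    rintro f ⟨hfa, hfΦ⟩
    have hΦ : ∀ z, T.eval z ∈ D → ∀ hz : a < h (T.eval z), ∀ F : ℂ → ℝ, (∀ x : R, F x = f x) →
        ∀ x ∈ A z, F x = F (x₀ z) := by
      intro z hzD hz F hFf x hx
      have hzM : z ∈ M.toFinset := by
        rw [Multiset.mem_toFinset, hM, Multiset.mem_filter, ← Multiset.count_pos, count_roots]
        exact ⟨(Finset.card_pos.2 ⟨x, hx⟩).trans_le (hcard z ⟨hzD, hz⟩), hzD, hz⟩
      have := congrFun (show Φ f = 0 from hfΦ) (⟨⟨z, hzM⟩, ⟨x, hx⟩⟩ : Q)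
      simp only [Φ, LinearMap.pi_apply, LinearMap.sub_apply, LinearMap.proj_apply, Pi.zero_apply,
        sub_eq_zero] at this
      rw [hFf ⟨x, (hR x).2 (hA z ⟨hzD, hz⟩ x hx)⟩, hFf ⟨x₀ z, (hR _).2 (hx₀ z ⟨hzD, hz⟩)⟩, this]
    have hleft : ∀ r, a < r →
        (∀ s, a ≤ s → s < r → f ∈ extendable R (T.eval ⁻¹' {w ∈ D | h w ≤ s})) →
        f ∈ extendable R (T.eval ⁻¹' {w ∈ D | h w ≤ r}) := by
      intro r hr hs
      obtain ⟨F, hF, hFf⟩ := mem_extendable_of_forall_lt hT hh hhc hR hw₀ hw₀a hr hs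
      have := mem_extendable_of_eventually_const hT hh hhc hw₀ hw₀a hR hr hF ?_
      · rwa [show (fun x : R => F x) = f from funext hFf] at this
      · rintro z hzD rfl
        exact hconst z ⟨hzD, hr⟩ F hF (hΦ z hzD hr F hFf)
    -- Continuous induction on the level: `hleft` gives closedness, `exists_gt_mem_extendable` the
    -- step to the right.
    let G : Set ℝ := {r | f ∈ extendable R (T.eval ⁻¹' {w ∈ D | h w ≤ r})}
    have hdown : ∀ s r, s ≤ r → r ∈ G → s ∈ G := by
      intro s r hsr hr
      have hsub : T.eval ⁻¹' {w ∈ D | h w ≤ s} ⊆ T.eval ⁻¹' {w ∈ D | h w ≤ r} :=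
        fun z hz => ⟨hz.1, hz.2.trans hsr⟩
      exact extendable_anti hsub hr
    have hclosed : IsClosed (G ∩ Icc a b) := by
      refine isClosed_of_closure_subset fun r hr => ?_
      have hrI : r ∈ Icc a b := closure_minimal inter_subset_right isClosed_Icc hr
      refine ⟨?_, hrI⟩
      rcases hrI.1.eq_or_lt with rfl | har
      · exact hfa
      · refine hleft r har fun s _ hsr => ?_
        obtain ⟨t, ht, htG⟩ := mem_closure_iff_nhds.1 hr _ (Ioi_mem_nhds hsr)
        exact hdown s t (le_of_lt ht) htG.1
    refine hclosed.Icc_subset_of_forall_exists_gt hfa ?_ (right_mem_Icc.2 hab)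
    rintro r ⟨hrG, hr⟩ y hy
    obtain ⟨r', hr', hfr'⟩ := exists_gt_mem_extendable hT hhc hcomp
      (fun x hx => by rw [(hR x).1 hx]; exact ⟨hw₀, hw₀a.trans hr.1⟩) hrG
    exact ⟨min r' y, hdown _ _ (min_le_left _ _) hfr', lt_min hr' hy, min_le_right _ _⟩
  -- Rank-nullity for `Φ` on `W`: the kernel extends to level `b`, the rank is at most `card Q`.
  set W := extendable R (T.eval ⁻¹' {w ∈ D | h w ≤ a})
  have h1 := (Φ.domRestrict W).finrank_range_add_finrank_ker
  have h2 : Module.finrank ℝ (LinearMap.range (Φ.domRestrict W)) ≤ Fintype.card Q := by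
    rw [← Module.finrank_fintype_fun_eq_card ℝ (η := Q)]
    exact Submodule.finrank_le _
  have h3 : Module.finrank ℝ (LinearMap.ker (Φ.domRestrict W)) ≤
      Module.finrank ℝ (extendable R (T.eval ⁻¹' {w ∈ D | h w ≤ b})) := by
    rw [← Submodule.finrank_map_subtype_eq W (LinearMap.ker (Φ.domRestrict W))]
    refine Submodule.finrank_mono (le_trans ?_ key)
    rintro _ ⟨f, hf, rfl⟩
    exact ⟨f.2, hf⟩
  have h4 : numZerosIn (derivative T) {z | T.eval z ∈ D ∧ a < h (T.eval z)} = M.card := by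
    rw [hM, numZerosIn]
    congr!
  omega

end Growth

/-! ### Counting zeros and fibre points. -/

section Counting

theorem numZerosIn_union (P : ℂ[X]) {A B : Set ℂ} (h : Disjoint A B) :
    numZerosIn P (A ∪ B) = numZerosIn P A + numZerosIn P B := by
  classical
  simp only [numZerosIn]
  rw [← Multiset.card_add, Multiset.filter_add_filter]
  have h0 : P.roots.filter (fun z => z ∈ A ∧ z ∈ B) = 0 :=
    Multiset.filter_eq_nil.2 fun z _ hz => h.le_bot hz
  rw [h0, add_zero]
  congr!

theorem numZerosIn_univ (P : ℂ[X]) : numZerosIn P univ = P.natDegree := by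
  classical
  simp only [numZerosIn, mem_univ, Multiset.filter_true]
  exact (IsAlgClosed.splits P).natDegree_eq_card_roots.symm

/-- A fibre point of multiplicity `e` is one point plus an `(e - 1)`-fold zero of `T'`, and the
multiplicities sum to the degree. -/
theorem card_fibre_add_numZerosIn {T : ℂ[X]} (hT : T.natDegree ≠ 0) {w₀ : ℂ} {R : Finset ℂ}
    (hR : ∀ x, x ∈ R ↔ T.eval x = w₀) :
    R.card + numZerosIn (derivative T) {z | T.eval z = w₀} = T.natDegree := by
  classical
  have hT0 : T - C w₀ ≠ 0 := fun h => hT (by rw [sub_eq_zero.1 h, natDegree_C])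
  have h1 : T.natDegree = (T - C w₀).roots.card := by
    rw [← (IsAlgClosed.splits (T - C w₀)).natDegree_eq_card_roots, natDegree_sub_C]
  have h2 : (T - C w₀).roots.card = ∑ x ∈ R, (T - C w₀).roots.count x :=
    (Multiset.sum_count_eq_card fun x hx => (hR x).2 (by
      simpa [hT0, sub_eq_zero] using hx)).symm
  have h3 : numZerosIn (derivative T) {z | T.eval z = w₀} =
      ∑ x ∈ R, (derivative T).roots.count x := by
    rw [numZerosIn, ← Multiset.sum_count_eq_card (s := R)
      fun x hx => (hR x).2 (by exact (Multiset.mem_filter.1 hx).2)]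
    exact Finset.sum_congr rfl fun x hx => Multiset.count_filter_of_pos ((hR x).1 hx)
  rw [h1, h2, h3, Finset.card_eq_sum_ones, ← Finset.sum_add_distrib]
  refine Finset.sum_congr rfl fun x hx => ?_
  rw [count_roots, count_roots, ← (hR x).1 hx, rootMultiplicity_sub_C_eval hT, add_comm]

theorem exists_finset_fibre {T : ℂ[X]} (hT : T.natDegree ≠ 0) (w₀ : ℂ) :
    ∃ R : Finset ℂ, ∀ x, x ∈ R ↔ T.eval x = w₀ := by
  classical
  have hT0 : T - C w₀ ≠ 0 := fun h => hT (by rw [sub_eq_zero.1 h, natDegree_C])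
  exact ⟨(T - C w₀).roots.toFinset, fun x => by simp [hT0, sub_eq_zero]⟩

theorem extendable_self (R : Finset ℂ) : extendable R (R : Set ℂ) = ⊤ := by
  classical
  refine eq_top_iff.2 fun f _ => ⟨fun x => if hx : x ∈ R then f ⟨x, hx⟩ else 0, ?_, ?_⟩
  · intro z _
    have hc : ((R : Set ℂ) \ {z})ᶜ ∈ 𝓝 z :=
      (R.finite_toSet.subset sdiff_subset).isClosed.isOpen_compl.mem_nhds (by simp)
    filter_upwards [mem_nhdsWithin_of_mem_nhds hc, self_mem_nhdsWithin] with ζ h1 h2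
    have : ζ = z := by
      by_contra hne
      exact h1 ⟨h2, hne⟩
    rw [this]
  · intro x
    simp

end Counting

/-! ### Components and dimension. -/

section Components

variable {T : ℂ[X]} {S : Set ℂ}

/-- The preimage of a compact preconnected set has finitely many connected components, as many as
the dimension of its space of locally constant functions. -/
theorem ncard_components_eq_finrank (hT : T.natDegree ≠ 0) (hS : IsPreconnected S)
    (hSc : IsCompact S) {w₀ : ℂ} (hw₀ : w₀ ∈ S) {R : Finset ℂ} (hR : ∀ x, x ∈ R ↔ T.eval x = w₀) :
    {B | IsConnectedComponentOf (T.eval ⁻¹' S) B}.Finite ∧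
      {B | IsConnectedComponentOf (T.eval ⁻¹' S) B}.ncard =
        Module.finrank ℝ (extendable R (T.eval ⁻¹' S)) := by
  classical
  have hdeg : 0 < T.degree := natDegree_pos_iff_degree_pos.1 (Nat.pos_of_ne_zero hT)
  set E := T.eval ⁻¹' S with hE
  set comps := {B | IsConnectedComponentOf E B} with hcomps
  have hEc : IsCompact E := (T.isProperMap_eval hdeg).isCompact_preimage hSc
  have hRE : ∀ x ∈ R, x ∈ E := fun x hx => by
    rw [hE, mem_preimage, (hR x).1 hx]; exact hw₀
  have hmeet : ∀ y ∈ E, ∃ x ∈ R, x ∈ connectedComponentIn E y := by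
    intro y hy
    obtain ⟨x, hx, hsep⟩ := exists_fibre_point_not_separated hT hS hw₀ hy
    refine ⟨x, (hR x).2 hx, ?_⟩
    have hxE := hRE x ((hR x).2 hx)
    have : CompactSpace E := isCompact_iff_compactSpace.1 hEc
    -- In a compact Hausdorff space a component is the intersection of the clopen sets around it, so
    -- indicators of clopen sets detect it.
    rw [connectedComponentIn_eq_image hy, connectedComponent_eq_iInter_isClopen]
    refine ⟨⟨x, hxE⟩, mem_iInter.2 ?_, rfl⟩
    rintro ⟨Z, hZ, hyZ⟩
    by_contra hxZ
    have hlc : LocConstOn E fun ζ => if ζ ∈ ((↑) '' Z : Set ℂ) then (1 : ℝ) else 0 := by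
      intro z hz
      have hmem : ∀ ζ (hζ : ζ ∈ E), ζ ∈ ((↑) '' Z : Set ℂ) ↔ (⟨ζ, hζ⟩ : E) ∈ Z := fun ζ hζ =>
        ⟨fun ⟨ξ, h1, h2⟩ => by subst h2; exact h1, fun h => ⟨_, h, rfl⟩⟩
      rw [← map_nhds_subtype_val ⟨z, hz⟩, eventually_map]
      by_cases hzZ : (⟨z, hz⟩ : E) ∈ Z
      · filter_upwards [hZ.isOpen.mem_nhds hzZ] with ζ hζ
        rw [if_pos ((hmem z hz).2 hzZ), if_pos ((hmem ζ ζ.2).2 hζ)]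
      · filter_upwards [hZ.compl.isOpen.mem_nhds hzZ] with ζ hζ
        rw [if_neg (fun h => hzZ ((hmem z hz).1 h)), if_neg (fun h => hζ ((hmem ζ ζ.2).1 h))]
    have h := hsep _ hlc
    rw [if_pos ⟨_, hyZ, rfl⟩, if_neg] at h
    · exact one_ne_zero h
    · rintro ⟨ξ, h1, h2⟩
      subst h2
      exact hxZ h1
  have hcompsR : comps = (fun x => connectedComponentIn E x) '' (R : Set ℂ) := by
    ext B
    constructor
    · rintro ⟨y, hy, rfl⟩
      obtain ⟨x, hxR, hx⟩ := hmeet y hy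
      exact ⟨x, hxR, (connectedComponentIn_eq hx).symm⟩
    · rintro ⟨x, hx, rfl⟩
      exact ⟨x, hRE x hx, rfl⟩
  have hfin : comps.Finite := hcompsR ▸ R.finite_toSet.image _
  refine ⟨hfin, ?_⟩
  have := hfin.fintype
  have hmemc : ∀ y ∈ E, connectedComponentIn E y ∈ comps := fun y hy => ⟨y, hy, rfl⟩
  -- Injective since every component meets `R`.
  let Ψ : (comps → ℝ) →ₗ[ℝ] (R → ℝ) := LinearMap.pi fun x =>
    LinearMap.proj (R := ℝ) (φ := fun _ : comps => ℝ) ⟨_, hmemc x (hRE x x.2)⟩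
  have hinj : Function.Injective Ψ := by
    intro g g' hgg
    funext ⟨B, y, hy, hB⟩
    obtain ⟨x, hxR, hx⟩ := hmeet y hy
    subst hB
    have h := congrFun hgg ⟨x, hxR⟩
    simp only [Ψ, LinearMap.pi_apply, LinearMap.proj_apply] at h
    simpa only [connectedComponentIn_eq hx] using h
  have hclosed : ∀ y, IsClosed (connectedComponentIn E y) := by
    intro y
    by_cases hy : y ∈ E
    · have hsub : closure (connectedComponentIn E y) ⊆ E :=
        closure_minimal (connectedComponentIn_subset E y) hEc.isClosed
      exact isClosed_of_closure_subset
        (isPreconnected_connectedComponentIn.closure.subset_connectedComponentIn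
          (subset_closure (mem_connectedComponentIn hy)) hsub)
    · rw [connectedComponentIn_eq_empty hy]
      exact isClosed_empty
  have hrange : LinearMap.range Ψ = extendable R E := by
    apply le_antisymm
    · rintro _ ⟨g, rfl⟩
      refine ⟨fun ζ => if hζ : ζ ∈ E then g ⟨_, hmemc ζ hζ⟩ else 0, ?_, ?_⟩
      · intro z hz
        have hcl : IsClosed (⋃ B ∈ comps \ {connectedComponentIn E z}, B) := by
          refine (hfin.subset sdiff_subset).isClosed_biUnion ?_
          rintro _ ⟨⟨y, _, rfl⟩, _⟩
          exact hclosed y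
        have hnot : z ∉ ⋃ B ∈ comps \ {connectedComponentIn E z}, B := by
          simp only [mem_iUnion, not_exists]
          rintro _ ⟨⟨y, _, rfl⟩, hne⟩ hzy
          exact hne (connectedComponentIn_eq hzy)
        filter_upwards [mem_nhdsWithin_of_mem_nhds (hcl.isOpen_compl.mem_nhds hnot),
          self_mem_nhdsWithin] with ζ h1 hζ
        have heq : connectedComponentIn E ζ = connectedComponentIn E z := by
          by_contra hne
          exact h1 (mem_biUnion (x := connectedComponentIn E ζ) ⟨hmemc ζ hζ, hne⟩
            (mem_connectedComponentIn hζ))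
        simp only [hζ, hz, dif_pos, heq]
      · intro x
        simp [Ψ, hRE x x.2]
    · rintro f ⟨F, hF, hFf⟩
      have hpt : ∀ B : comps, ∃ x, x ∈ (B : Set ℂ) := by
        rintro ⟨_, y, hy, rfl⟩
        exact ⟨y, mem_connectedComponentIn hy⟩
      choose p hp using hpt
      refine ⟨fun B => F (p B), ?_⟩
      funext x
      simp only [Ψ, LinearMap.pi_apply, LinearMap.proj_apply]
      rw [← hFf x]
      exact (hF.mono (connectedComponentIn_subset E x)).eq_of_isPreconnected
        isPreconnected_connectedComponentIn (hp ⟨_, hmemc x (hRE x x.2)⟩)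
        (mem_connectedComponentIn (hRE x x.2))
  rw [← hrange, LinearMap.finrank_range_of_inj hinj, Module.finrank_fintype_fun_eq_card,
    ← Nat.card_coe_set_eq, Nat.card_eq_fintype_card]

/-- Listing all connected components of `E` without repetition as `B 1, …, B k` is possible exactly
when there are `k` of them. -/
theorem exists_fin_components_iff {E : Set ℂ}
    (hfin : {B | IsConnectedComponentOf E B}.Finite) (k : ℕ) :
    (∃ B : Fin k → Set ℂ, (∀ i, IsConnectedComponentOf E (B i)) ∧ (⋃ i, B i) = E ∧
      (∀ i j, i ≠ j → B i ∩ B j = ∅)) ↔ {B | IsConnectedComponentOf E B}.ncard = k := by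
  constructor
  · rintro ⟨B, hB, hU, hdisj⟩
    have hinj : Function.Injective B := by
      intro i j hij
      by_contra hne
      have h := hdisj i j hne
      rw [← hij, inter_self] at h
      obtain ⟨z, hz, hBz⟩ := hB i
      have hmem := mem_connectedComponentIn hz
      rw [← hBz, h] at hmem
      exact hmem
    have hrange : {B | IsConnectedComponentOf E B} = range B := by
      ext A
      constructor
      · rintro ⟨z, hz, rfl⟩
        obtain ⟨i, hi⟩ := mem_iUnion.1 (hU.ge hz)
        refine ⟨i, ?_⟩
        obtain ⟨y, hy, hBy⟩ := hB i
        rw [hBy] at hi ⊢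
        exact connectedComponentIn_eq hi
      · rintro ⟨i, rfl⟩
        exact hB i
    rw [hrange, ← Nat.card_coe_set_eq, Nat.card_range_of_injective hinj, Nat.card_fin]
  · intro hk
    have := hfin.to_subtype
    let e := Finite.equivFinOfCardEq ((Nat.card_coe_set_eq _).trans hk)
    refine ⟨fun i => (e.symm i : Set ℂ), fun i => (e.symm i).2, ?_, ?_⟩
    · apply Subset.antisymm
      · refine iUnion_subset fun i => ?_
        obtain ⟨z, hz, hBz⟩ := (e.symm i).2
        rw [hBz]
        exact connectedComponentIn_subset E z
      · intro z hz
        refine mem_iUnion.2 ⟨e ⟨_, z, hz, rfl⟩, ?_⟩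
        rw [e.symm_apply_apply]
        exact mem_connectedComponentIn hz
    · intro i j hij
      by_contra hne
      obtain ⟨x, hxi, hxj⟩ := nonempty_iff_ne_empty.2 hne
      obtain ⟨y, _, hBy⟩ := (e.symm i).2
      obtain ⟨y', _, hBy'⟩ := (e.symm j).2
      refine hij (e.symm.injective (Subtype.ext ?_))
      replace hxi : x ∈ (e.symm i : Set ℂ) := hxi
      replace hxj : x ∈ (e.symm j : Set ℂ) := hxj
      rw [hBy] at hxi ⊢
      rw [hBy'] at hxj ⊢
      rw [connectedComponentIn_eq hxi, connectedComponentIn_eq hxj]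

end Components

/-! ### The two inequalities for the interval. -/

section Interval

/-- The real interval `[-1, 1]` as a subset of `ℂ`. -/
def complexUnitInterval : Set ℂ := {w | ∃ x : ℝ, x ∈ Icc (-1 : ℝ) 1 ∧ w = x}

theorem complexUnitInterval_eq_image :
    complexUnitInterval = Complex.ofRealCLM '' Icc (-1 : ℝ) 1 := by
  ext w
  simp [complexUnitInterval, eq_comm]

theorem mem_complexUnitInterval_iff {w : ℂ} :
    w ∈ complexUnitInterval ↔ w.re ∈ Icc (-1 : ℝ) 1 ∧ w.im = 0 := by
  constructor
  · rintro ⟨x, hx, rfl⟩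
    simpa using hx
  · rintro ⟨h1, h2⟩
    exact ⟨w.re, h1, Complex.ext rfl h2⟩

theorem convex_complexUnitInterval : Convex ℝ complexUnitInterval := by
  rw [complexUnitInterval_eq_image]
  exact (convex_Icc _ _).linear_image Complex.ofRealCLM.toLinearMap

theorem isCompact_complexUnitInterval : IsCompact complexUnitInterval := by
  rw [complexUnitInterval_eq_image]
  exact isCompact_Icc.image Complex.ofRealCLM.continuous

theorem neg_one_mem_complexUnitInterval : (-1 : ℂ) ∈ complexUnitInterval :=
  ⟨-1, by norm_num, by simp⟩

variable {T : ℂ[X]} {R : Finset ℂ}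

/-- Sweep the interval by the real part, starting from `{-1}`, whose preimage is the discrete set
`R`. -/
theorem natDegree_le_finrank_add_numZerosIn (hT : T.natDegree ≠ 0)
    (hR : ∀ x, x ∈ R ↔ T.eval x = -1) :
    T.natDegree ≤ Module.finrank ℝ (extendable R (T.eval ⁻¹' complexUnitInterval)) +
      numZerosIn (derivative T) (T.eval ⁻¹' complexUnitInterval) := by
  have h := finrank_extendable_le (D := complexUnitInterval) (h := Complex.re) (a := -1) (b := 1)
    (w₀ := -1) (R := R) hT (Complex.reLm.convexOn convex_complexUnitInterval)
    Complex.continuous_re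
    (fun r => isCompact_complexUnitInterval.inter_right
      (isClosed_le Complex.continuous_re continuous_const))
    neg_one_mem_complexUnitInterval (by simp) hR (by norm_num)
  have ha : T.eval ⁻¹' {w ∈ complexUnitInterval | w.re ≤ -1} = R := by
    ext z
    rw [Finset.mem_coe, hR]
    constructor
    · rintro ⟨⟨x, hx, hzx⟩, hre⟩
      replace hre : (T.eval z).re ≤ -1 := hre
      replace hzx : T.eval z = x := hzx
      rw [hzx, Complex.ofReal_re] at hre
      rw [hzx, le_antisymm hre hx.1]
      simp
    · intro hz
      rw [mem_preimage, hz]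
      exact ⟨neg_one_mem_complexUnitInterval, by simp⟩
  have hb : {w ∈ complexUnitInterval | w.re ≤ 1} = complexUnitInterval :=
    sep_eq_self_iff_mem_true.2 fun w hw => (mem_complexUnitInterval_iff.1 hw).1.2
  rw [ha, hb, extendable_self, finrank_top, Module.finrank_fintype_fun_eq_card,
    Fintype.card_coe] at h
  have hunion : T.eval ⁻¹' complexUnitInterval = {z | T.eval z = -1} ∪
      {z | T.eval z ∈ complexUnitInterval ∧ -1 < (T.eval z).re} := by
    ext z
    constructor
    · intro hz
      rcases (mem_complexUnitInterval_iff.1 hz).1.1.eq_or_lt with h1 | h1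
      · exact Or.inl (Complex.ext (by simpa using h1.symm)
          (by simpa using (mem_complexUnitInterval_iff.1 hz).2))
      · exact Or.inr ⟨hz, h1⟩
    · rintro (hz | hz)
      · rw [mem_preimage, show T.eval z = -1 from hz]
        exact neg_one_mem_complexUnitInterval
      · exact hz.1
  have hcount := numZerosIn_union (derivative T) (A := {z | T.eval z = -1})
    (B := {z | T.eval z ∈ complexUnitInterval ∧ -1 < (T.eval z).re})
    (Set.disjoint_left.2 fun z (hz : T.eval z = -1) hz' => by
      have h2 := hz'.2
      rw [hz] at h2
      simp at h2)
  rw [← hunion] at hcount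
  have := card_fibre_add_numZerosIn hT hR
  omega

theorem finrank_add_numZerosIn_le_natDegree (hT : T.natDegree ≠ 0)
    (hR : ∀ x, x ∈ R ↔ T.eval x = -1) :
    Module.finrank ℝ (extendable R (T.eval ⁻¹' complexUnitInterval)) +
      numZerosIn (derivative T) (T.eval ⁻¹' complexUnitInterval) ≤ T.natDegree := by
  -- For `r ≥ 0` the set `g ≤ r` is the rectangle `[-1-r, 1+r] × [-r, r]`, which is the interval at
  -- `r = 0`.
  set g : ℂ → ℝ := fun w => max |w.im| (|w.re| - 1) with hg
  have hgc : Continuous g := by fun_prop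
  have hgconv : ConvexOn ℝ univ g := by
    have habs : ConvexOn ℝ univ fun x : ℝ => |x| := by
      simpa using! convexOn_univ_norm (E := ℝ)
    have him : ConvexOn ℝ univ fun w : ℂ => |w.im| := habs.comp_linearMap Complex.imLm
    have hre : ConvexOn ℝ univ fun w : ℂ => |w.re| := habs.comp_linearMap Complex.reLm
    exact him.sup (hre.add_const (-1))
  have hcomp : ∀ r, IsCompact {w ∈ (univ : Set ℂ) | g w ≤ r} := by
    intro r
    have hcl : IsClosed {w ∈ (univ : Set ℂ) | g w ≤ r} := by
      simpa using isClosed_le hgc continuous_const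
    refine Metric.isCompact_of_isClosed_isBounded hcl
      ((Metric.isBounded_closedBall (x := (0 : ℂ)) (r := (r + 1) + r)).subset ?_)
    rintro w ⟨-, hw⟩
    have h1 := max_le_iff.1 (show max |w.im| (|w.re| - 1) ≤ r from hw)
    rw [mem_closedBall_zero_iff]
    exact (Complex.norm_le_abs_re_add_abs_im w).trans (by linarith [h1.1, h1.2])
  have hzero : ∀ w, g w ≤ 0 ↔ w ∈ complexUnitInterval := by
    intro w
    rw [mem_complexUnitInterval_iff, mem_Icc, ← abs_le, hg]
    simp only [max_le_iff, abs_nonpos_iff, sub_nonpos]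
    exact and_comm
  -- At level `max b 0` the preimage contains a disc that contains `R`, so only constants remain.
  obtain ⟨M, hM⟩ := R.finite_toSet.isBounded.subset_closedBall 0
  obtain ⟨b, hb⟩ := ((isCompact_closedBall (0 : ℂ) M).image
    (hgc.comp T.continuous)).bddAbove
  have h := finrank_extendable_le (D := univ) (h := g) (a := 0) (b := max b 0)
    (w₀ := -1) (R := R) hT hgconv hgc hcomp (mem_univ _)
    ((hzero _).2 neg_one_mem_complexUnitInterval) hR (le_max_right _ _)
  have ha : {w ∈ (univ : Set ℂ) | g w ≤ 0} = complexUnitInterval := by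
    ext w
    simp [hzero]
  have hone : Module.finrank ℝ (extendable R (T.eval ⁻¹' {w ∈ (univ : Set ℂ) | g w ≤ max b 0})) ≤
      1 := by
    refine (Submodule.finrank_mono (t := Submodule.span ℝ {fun _ : R => (1 : ℝ)}) ?_).trans
      ((finrank_span_le_card _).trans (by simp))
    rintro f ⟨F, hF, hFf⟩
    have hconst : ∀ x y : R, f x = f y := by
      intro x y
      rw [← hFf, ← hFf]
      refine (hF.mono ?_).eq_of_isPreconnected (convex_closedBall (0 : ℂ) M).isPreconnected
        (hM x.2) (hM y.2)
      intro z hz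
      exact ⟨mem_univ _, (hb (mem_image_of_mem _ hz)).trans (le_max_left _ _)⟩
    rw [Submodule.mem_span_singleton]
    rcases isEmpty_or_nonempty R with hemp | ⟨⟨x⟩⟩
    · exact ⟨0, funext fun y => (hemp.false y).elim⟩
    · exact ⟨f x, funext fun y => by simp [hconst x y]⟩
  rw [ha] at h
  have hcount := numZerosIn_union (derivative T) (A := T.eval ⁻¹' complexUnitInterval)
    (B := {z | T.eval z ∈ univ ∧ 0 < g (T.eval z)})
    (Set.disjoint_left.2 fun z hz hz' => hz'.2.not_ge ((hzero _).2 hz))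
  have hunion : T.eval ⁻¹' complexUnitInterval ∪ {z | T.eval z ∈ univ ∧ 0 < g (T.eval z)} =
      univ := by
    refine eq_univ_of_forall fun z => ?_
    rcases le_or_gt (g (T.eval z)) 0 with h1 | h1
    · exact Or.inl ((hzero _).1 h1)
    · exact Or.inr ⟨mem_univ _, h1⟩
  rw [hunion, numZerosIn_univ, natDegree_derivative] at hcount
  omega

end Interval

theorem theorem5 (n : ℕ) (T : Polynomial ℂ) (hT : T.natDegree = n)
    (k : ℕ) (hk1 : 1 ≤ k) (hkn : k ≤ n) :
    (∃ B : Fin k → Set ℂ,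
        (∀ i, IsConnectedComponentOf (inverseImage T) (B i)) ∧
        (⋃ i, B i) = inverseImage T ∧
        (∀ i j, i ≠ j → B i ∩ B j = ∅)) ↔
      numZerosIn (Polynomial.derivative T) (inverseImage T) = n - k := by
  have hT0 : T.natDegree ≠ 0 := by omega
  obtain ⟨R, hR⟩ := exists_finset_fibre hT0 (-1)
  have hE : inverseImage T = T.eval ⁻¹' complexUnitInterval := rfl
  have hle := finrank_add_numZerosIn_le_natDegree hT0 hR
  have hge := natDegree_le_finrank_add_numZerosIn hT0 hR
  obtain ⟨hfin, hcard⟩ := ncard_components_eq_finrank hT0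
    convex_complexUnitInterval.isPreconnected isCompact_complexUnitInterval
    neg_one_mem_complexUnitInterval hR
  rw [hE, exists_fin_components_iff hfin, hcard]
  -- The bounds give dimension plus zeros equal to `n`; `k ≤ n` makes the truncated `n - k`
  -- harmless.
  omega
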